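/- Let $\mathfrak g$ be a finite-dimensional perfect Lie algebra over $\mathbb C$ with Levi decomposition $\mathfrak g=\mathfrak g_L\ltimes\mathfrak h$, where $\mathfrak h=\operatorname{Rad}(\mathfrak g)\neq 0$ and the Levi subalgebra $\mathfrak g_L$ is simple, and suppose $[\mathfrak h,\mathfrak h]\subseteq Z(\mathfrak h)$, where $Z$ denotes the centre. Then $\mathfrak g$ is not sympathetic, i.e. it is not the case that $Z(\mathfrak g)=0$, $[\mathfrak g,\mathfrak g]=\mathfrak g$ and every derivation of $\mathfrak g$ is inner. Moreover, there is a $\mathfrak g_L$-submodule $V\subseteq\mathfrak h$ with $\mathfrak h=V\oplus Z(\mathfrak h)$, and for every such $V$ the linear map $D\colon\mathfrak g\to\mathfrak g$ with $D|_{\mathfrak g_L}=0$, $D|_{Z(\mathfrak h)}=\operatorname{Id}$ and $D|_V=\tfrac12\operatorname{Id}$ is an outer (that is, non-inner) derivation of $\mathfrak g$. -/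

import Mathlib

/-- A Lie algebra is perfect if it equals its derived algebra. -/
def LieIsPerfect (R L : Type*) [CommRing R] [LieRing L] [LieAlgebra R L] : Prop :=
  ⁅(⊤ : LieIdeal R L), (⊤ : LieIdeal R L)⁆ = ⊤

/-- A derivation of `L` is inner if it equals `ad x` for some `x : L`. -/
def LieDerivationIsInner {R L : Type*} [CommRing R] [LieRing L] [LieAlgebra R L]
    (D : LieDerivation R L L) : Prop :=
  D ∈ (LieDerivation.ad R L).range

/-- A Lie algebra is sympathetic if its centre is trivial, it is perfect, and all of its
derivations are inner. -/
structure LieIsSympathetic (R L : Type*) [CommRing R] [LieRing L] [LieAlgebra R L] : Prop where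
  center_eq_bot : LieAlgebra.center R L = ⊥
  perfect : LieIsPerfect R L
  inner : ∀ D : LieDerivation R L L, LieDerivationIsInner D

/-- `S` is a Levi subalgebra of `L`: a semisimple subalgebra which is a vector space complement
of the radical, so that `L = S ⋉ Rad(L)`. -/
structure IsLeviSubalgebra {R L : Type*} [CommRing R] [LieRing L] [LieAlgebra R L]
    (S : LieSubalgebra R L) : Prop where
  semisimple : LieAlgebra.IsSemisimple R S
  isCompl : IsCompl S.toSubmodule (LieAlgebra.radical R L).toSubmodule

/-! Give `𝔤L`, `V`, `Z(𝔥)` the weights 0, 1/2, 1. As `V` is `𝔤L`-stable and `[V, V] ⊆ Z(𝔥)`,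
brackets add weights, so scaling by weight is a derivation. If it were `ad (s + a)` with `s ∈ 𝔤L`,
`a ∈ 𝔥`, vanishing on `𝔤L` would make `s` central in `𝔤L`, hence 0; but `ad a` kills `Z(𝔥)`, where
`D` is the identity. So `Z(𝔥) = 0`, whence `[𝔥, 𝔥] = 0` and `𝔥 = Z(𝔥) = 0`, a contradiction. The
existence of `V` is Weyl's theorem, deduced from Whitehead's first lemma, which rests on the Casimir
operator of a trace form. -/

open Module

/-! ### Casimir operators and derivations into irreducible modules -/

section Casimir

variable {K L M : Type*} [Field K] [LieRing L] [LieAlgebra K L]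
  [AddCommGroup M] [Module K M] [LieRingModule L M] [LieModule K L M]

/-- For an invariant symmetric nondegenerate form on `L`, the canonical tensor `∑ bᵢ ⊗ bⁱ` attached
to a pair of dual bases is annihilated by `L`. -/
theorem sum_dualBasis_lie_add_lie_eq_zero {ι P : Type*} [Fintype ι] [DecidableEq ι]
    [AddCommGroup P] [Module K P] {B : LinearMap.BilinForm K L} (hB : B.Nondegenerate)
    (hsymm : B.IsSymm) (hinv : ∀ x y z : L, B ⁅x, y⁆ z = B x ⁅y, z⁆)
    (b : Basis ι K L) (Φ : L →ₗ[K] L →ₗ[K] P) (x : L) :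
    ∑ i, (Φ ⁅x, b i⁆ (B.dualBasis hB b i) + Φ (b i) ⁅x, B.dualBasis hB b i⁆) = 0 := by
  set c := B.dualBasis hB b with hc
  have hb : ∀ y : L, y = ∑ j, B y (c j) • b j := by
    intro y
    have h2 : ∀ j, b.repr y j = B y (c j) := by
      intro j
      conv_rhs => rw [← b.sum_repr y]
      simp only [map_sum, map_smul, LinearMap.sum_apply, LinearMap.smul_apply, hc,
        LinearMap.BilinForm.apply_dualBasis_right hB hsymm]
      simp
    simp_rw [← h2]
    exact (b.sum_repr y).symm
  have hc' : ∀ y : L, y = ∑ j, B y (b j) • c j := by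
    intro y
    have := (c.sum_repr y).symm
    simpa only [hc, LinearMap.BilinForm.dualBasis_repr_apply] using this
  -- By invariance, the matrices of `ad x` in dual bases are negative transposes of each other.
  have key : ∀ i j, B ⁅x, b i⁆ (c j) = - B ⁅x, c j⁆ (b i) := by
    intro i j
    rw [← lie_skew x (b i), map_neg, LinearMap.neg_apply, hinv, hsymm.eq (b i)]
  have h1 : ∀ i, Φ ⁅x, b i⁆ (c i) = ∑ j, B ⁅x, b i⁆ (c j) • Φ (b j) (c i) := by
    intro i
    conv_lhs => rw [hb ⁅x, b i⁆]
    simp [LinearMap.sum_apply]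
  have h2 : ∀ i, Φ (b i) ⁅x, c i⁆ = ∑ j, B ⁅x, c i⁆ (b j) • Φ (b i) (c j) := by
    intro i
    conv_lhs => rw [hc' ⁅x, c i⁆]
    simp
  simp_rw [Finset.sum_add_distrib, h1, h2]
  rw [Finset.sum_comm, ← Finset.sum_add_distrib]
  refine Finset.sum_eq_zero fun i _ => ?_
  rw [← Finset.sum_add_distrib]
  refine Finset.sum_eq_zero fun j _ => ?_
  rw [key, neg_smul, neg_add_cancel]

variable (M) in
/-- A derivation into a simple module with nondegenerate trace form is inner: the Casimir operator
of the trace form is invertible because its trace is `dim L`. -/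
theorem LieDerivation.exists_eq_lie_of_traceForm_nondegenerate [CharZero K]
    [FiniteDimensional K L] [Nontrivial L] [FiniteDimensional K M] [LieModule.IsIrreducible K L M]
    (hB : (LieModule.traceForm K L M).Nondegenerate) (D : LieDerivation K L M) :
    ∃ m : M, ∀ x, D x = ⁅x, m⁆ := by
  classical
  set B := LieModule.traceForm K L M with hBdef
  let b := finBasis K L
  set c := B.dualBasis hB b with hc
  have hsymm : B.IsSymm := ⟨LieModule.traceForm_comm K L M⟩
  have hinv : ∀ x y z : L, B ⁅x, y⁆ z = B x ⁅y, z⁆ := LieModule.traceForm_apply_lie_apply K L M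
  let φ := LieModule.toEnd K L M
  let C : M →ₗ[K] M := ∑ i, φ (b i) ∘ₗ φ (c i)
  have hC : ∀ m, C m = ∑ i, ⁅b i, ⁅c i, m⁆⁆ := fun m => by simp [C, φ, LinearMap.sum_apply]
  have hCx : ∀ (x : L) (m : M), C ⁅x, m⁆ = ⁅x, C m⁆ := by
    intro x m
    let Φ : L →ₗ[K] L →ₗ[K] M := LinearMap.mk₂ K (fun a d => ⁅a, ⁅d, m⁆⁆)
      (by simp) (by simp) (by simp) (by simp)
    have h := sum_dualBasis_lie_add_lie_eq_zero hB hsymm hinv b Φ x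
    simp only [Φ, LinearMap.mk₂_apply, ← hc] at h
    rw [hC, hC, lie_sum, ← sub_eq_zero, ← Finset.sum_sub_distrib, ← neg_eq_zero,
      ← Finset.sum_neg_distrib, ← h]
    refine Finset.sum_congr rfl fun i _ => ?_
    simp only [lie_lie, lie_sub]
    abel
  -- If `D x = ⁅x, m⁆` for all `x`, then this sum is `C m`; so the sought `m` is the preimage of
  -- `m₀` under `C`.
  let m₀ : M := ∑ i, ⁅b i, D (c i)⁆
  have hm₀ : ∀ x : L, ⁅x, m₀⁆ = C (D x) := by
    intro x
    let Φ : L →ₗ[K] L →ₗ[K] M := LinearMap.mk₂ K (fun a d => ⁅a, D d⁆)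
      (by simp) (by simp) (by simp) (by simp)
    have h := sum_dualBasis_lie_add_lie_eq_zero hB hsymm hinv b Φ x
    simp only [Φ, LinearMap.mk₂_apply, ← hc] at h
    rw [hC, lie_sum, ← sub_eq_zero, ← Finset.sum_sub_distrib, ← h]
    refine Finset.sum_congr rfl fun i _ => ?_
    rw [LieDerivation.apply_lie_eq_sub]
    simp only [lie_lie, lie_sub]
    abel
  have htr : LinearMap.trace K M C = (finrank K L : K) := by
    have : ∀ i, LinearMap.trace K M (φ (b i) ∘ₗ φ (c i)) = 1 := by
      intro i
      rw [← LieModule.traceForm_apply_apply]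
      simpa using LinearMap.BilinForm.apply_dualBasis_right hB hsymm b i i
    simp [C, map_sum, this]
  have hC0 : C ≠ 0 := by
    intro h
    rw [h, map_zero, eq_comm, Nat.cast_eq_zero] at htr
    exact finrank_pos.ne' htr
  let C' : M →ₗ⁅K, L⁆ M := { C with map_lie' := fun {x m} => hCx x m }
  have hker : C'.ker = ⊥ := by
    refine (eq_bot_or_eq_top C'.ker).resolve_right fun h => hC0 ?_
    ext m
    have : m ∈ C'.ker := h ▸ LieSubmodule.mem_top m
    exact LieModuleHom.mem_ker.mp this
  have hinj : Function.Injective C := (LieModuleHom.ker_eq_bot C').mp hker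
  obtain ⟨m, hm⟩ := (LinearMap.injective_iff_surjective.mp hinj) m₀
  exact ⟨m, fun x => hinj (by rw [hCx, hm, hm₀])⟩

end Casimir

/-! ### Whitehead's first lemma and complete reducibility -/

section Whitehead

variable {K L : Type*} [Field K] [LieRing L] [LieAlgebra K L] [LieAlgebra.IsSimple K L]

variable (K L) in
theorem LieAlgebra.IsSimple.lie_top_top : ⁅(⊤ : LieIdeal K L), (⊤ : LieIdeal K L)⁆ = ⊤ := by
  refine (LieAlgebra.IsSimple.eq_bot_or_eq_top (R := K) _).resolve_left fun h => ?_
  refine LieAlgebra.IsSimple.non_abelian K (L := L) ⟨fun x y => ?_⟩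
  have : ⁅x, y⁆ ∈ ⁅(⊤ : LieIdeal K L), (⊤ : LieIdeal K L)⁆ :=
    LieSubmodule.lie_mem_lie (LieSubmodule.mem_top x) (LieSubmodule.mem_top y)
  rwa [h, LieSubmodule.mem_bot] at this

theorem LieDerivation.eq_zero_of_isTrivial {M : Type*} [AddCommGroup M] [Module K M]
    [LieRingModule L M] [LieModule K L M] [LieModule.IsTrivial L M] (D : LieDerivation K L M)
    (x : L) : D x = 0 := by
  have hx : x ∈ (⁅(⊤ : LieIdeal K L), (⊤ : LieIdeal K L)⁆ : LieIdeal K L).toSubmodule := by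
    rw [LieAlgebra.IsSimple.lie_top_top]
    exact LieSubmodule.mem_top x
  rw [LieSubmodule.lieIdeal_oper_eq_linear_span] at hx
  induction hx using Submodule.span_induction with
  | mem x h =>
    obtain ⟨a, b, rfl⟩ := h
    rw [LieDerivation.apply_lie_eq_sub, LieModule.IsTrivial.trivial, LieModule.IsTrivial.trivial,
      sub_zero]
  | zero => simp
  | add a b _ _ ha hb => rw [map_add, ha, hb, add_zero]
  | smul r a _ ha => rw [map_smul, ha, smul_zero]

/-- Invariance makes the radical of the form an ideal, so simplicity leaves only `⊥` and `⊤`. -/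
theorem LieModule.traceForm_nondegenerate_of_ne_zero {M : Type*} [AddCommGroup M] [Module K M]
    [LieRingModule L M] [LieModule K L M] [FiniteDimensional K L]
    (h : LieModule.traceForm K L M ≠ 0) :
    (LieModule.traceForm K L M).Nondegenerate := by
  rw [LinearMap.BilinForm.nondegenerate_iff_ker_eq_bot]
  let I : LieIdeal K L :=
    { LinearMap.ker (LieModule.traceForm K L M) with
      lie_mem := by
        intro x y hy
        change LieModule.traceForm K L M ⁅x, y⁆ = 0
        replace hy : LieModule.traceForm K L M y = 0 := hy
        ext z
        rw [← lie_skew, map_neg, LinearMap.neg_apply, LieModule.traceForm_apply_lie_apply, hy]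
        simp }
  rcases LieAlgebra.IsSimple.eq_bot_or_eq_top (R := K) I with hI | hI
  · exact congrArg LieSubmodule.toSubmodule hI
  · refine absurd ?_ h
    exact LinearMap.ker_eq_top.mp (congrArg LieSubmodule.toSubmodule hI)

/-- A vanishing trace form makes the derived algebra, here all of `L`, act nilpotently. The
invariants are then a nonzero submodule, so everything by irreducibility. -/
theorem LieModule.isTrivial_of_traceForm_eq_zero {M : Type*} [AddCommGroup M] [Module K M]
    [LieRingModule L M] [LieModule K L M] [FiniteDimensional K M] [LieModule.IsIrreducible K L M]
    [CharZero K] (h : LieModule.traceForm K L M = 0) : LieModule.IsTrivial L M := by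
  have h1 := LieModule.isNilpotent_derivedSeries_of_traceForm_eq_zero h
  have htop : LieAlgebra.derivedSeries K L 1 = ⊤ := LieAlgebra.IsSimple.lie_top_top K L
  rw [LieModule.isNilpotent_iff_forall' (R := K)] at h1
  have h2 : LieModule.IsNilpotent L M := by
    rw [LieModule.isNilpotent_iff_forall' (R := K)]
    exact fun x => h1 ⟨x, htop ▸ LieSubmodule.mem_top x⟩
  have := LieModule.nontrivial_of_isIrreducible K L M
  have := LieModule.nontrivial_max_triv_of_isNilpotent K L M
  rw [LieModule.isTrivial_iff_max_triv_eq_top K]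
  exact LieSubmodule.eq_top_of_isIrreducible K L M _

variable [CharZero K] [FiniteDimensional K L]

/-- **Whitehead's first lemma** for a simple Lie algebra in characteristic zero. -/
theorem LieDerivation.exists_eq_lie {M : Type*} [AddCommGroup M] [Module K M]
    [LieRingModule L M] [LieModule K L M] [FiniteDimensional K M] (D : LieDerivation K L M) :
    ∃ m : M, ∀ x, D x = ⁅x, m⁆ := by
  induction hn : finrank K M using Nat.strong_induction_on generalizing M with
  | _ n ih =>
  rcases subsingleton_or_nontrivial M with hM | hM
  · exact ⟨0, fun x => Subsingleton.elim _ _⟩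
  by_cases hirr : LieModule.IsIrreducible K L M
  · by_cases h : LieModule.traceForm K L M = 0
    · have := LieModule.isTrivial_of_traceForm_eq_zero h
      exact ⟨0, fun x => by simp [D.eq_zero_of_isTrivial]⟩
    · have : Nontrivial L := LieAlgebra.IsSimple.nontrivial K L
      exact D.exists_eq_lie_of_traceForm_nondegenerate M
        (LieModule.traceForm_nondegenerate_of_ne_zero h)
  obtain ⟨N, hbot, htop⟩ : ∃ N : LieSubmodule K L M, N ≠ ⊥ ∧ N ≠ ⊤ := by
    by_contra! h
    exact hirr (LieModule.IsIrreducible.mk h)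
  have hsum := N.toSubmodule.finrank_quotient_add_finrank
  have hN : 0 < finrank K N := by
    have := (LieSubmodule.nontrivial_iff_ne_bot K L M).mpr hbot
    exact finrank_pos
  have hN' : finrank K N < finrank K M :=
    Submodule.finrank_lt fun h => htop (by simpa using h)
  -- Reducible case: solve modulo `N`, lift the solution to `m`, then solve for the remaining
  -- `N`-valued derivation `x ↦ D x - ⁅x, m⁆`.
  let Dq : LieDerivation K L (M ⧸ N) :=
    { toLinearMap := (LieSubmodule.Quotient.mk' N : M →ₗ[K] M ⧸ N) ∘ₗ (D : L →ₗ[K] M)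
      leibniz' := fun a b => by
        simp only [LinearMap.comp_apply, LieDerivation.coeFn_coe, LieDerivation.apply_lie_eq_sub,
          map_sub, LieModuleHom.coe_toLinearMap, LieModuleHom.map_lie] }
  have hlt : finrank K (M ⧸ N) < n := by
    change finrank K (M ⧸ N.toSubmodule) < n
    change _ + finrank K N = _ at hsum
    omega
  obtain ⟨q, hq⟩ := ih _ hlt Dq rfl
  obtain ⟨m, rfl⟩ := LieSubmodule.Quotient.surjective_mk' N q
  have hmem : ∀ x, D x - ⁅x, m⁆ ∈ N := by
    intro x
    have := hq x
    rw [← LieModuleHom.map_lie] at this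
    rw [← LieSubmodule.Quotient.mk_eq_zero]
    rw [map_sub, ← this]
    exact sub_self _
  let Ds : LieDerivation K L N :=
    { toFun := fun x => ⟨D x - ⁅x, m⁆, hmem x⟩
      map_add' := fun x y => by
        ext
        simp only [map_add, add_lie, LieSubmodule.coe_add]
        abel
      map_smul' := fun r x => by
        ext
        simp [smul_sub]
      leibniz' := fun a b => by
        ext
        simp only [LinearMap.coe_mk, AddHom.coe_mk, LieDerivation.apply_lie_eq_sub,
          LieSubmodule.coe_sub, LieSubmodule.coe_bracket, lie_sub, lie_lie]
        abel }
  obtain ⟨w, hw⟩ := ih _ (hn ▸ hN') Ds rfl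
  refine ⟨m + w, fun x => ?_⟩
  have := congrArg Subtype.val (hw x)
  change D x - ⁅x, m⁆ = ⁅x, (w : M)⁆ at this
  rw [lie_add, ← this, add_sub_cancel]

/-- **Weyl's theorem on complete reducibility** for a simple Lie algebra in characteristic zero. -/
theorem LieSubmodule.exists_isCompl_toSubmodule {M : Type*} [AddCommGroup M] [Module K M]
    [LieRingModule L M] [LieModule K L M] [FiniteDimensional K M] (W : LieSubmodule K L M) :
    ∃ V : LieSubmodule K L M, IsCompl V.toSubmodule W.toSubmodule := by
  obtain ⟨p, hp⟩ := (W.incl : W →ₗ[K] M).exists_leftInverse_of_injective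
    (LinearMap.ker_eq_bot.mpr Subtype.val_injective)
  replace hp : ∀ w : W, p w = w := fun w => LinearMap.congr_fun hp w
  -- The failure of the linear retraction `p` to be equivariant is a derivation `x ↦ ⁅x, p⁆` into
  -- the maps vanishing on `W`. Writing it as `x ↦ ⁅x, q⁆` makes `p - q` an equivariant retraction,
  -- whose kernel is the complement.
  let N : LieSubmodule K L (M →ₗ[K] W) :=
    { carrier := {φ | ∀ w : W, φ w = 0}
      add_mem' := fun {a b} ha hb w => by simp [ha w, hb w]
      zero_mem' := fun w => rfl
      smul_mem' := fun r a ha w => by simp [ha w]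
      lie_mem := fun {x φ} hφ w => by
        have h := hφ ⁅x, w⁆
        rw [LieSubmodule.coe_bracket] at h
        rw [LieHom.lie_apply, hφ w, h, lie_zero, sub_zero] }
  have hmem : ∀ x : L, ⁅x, p⁆ ∈ N := by
    intro x w
    have h := hp ⁅x, w⁆
    rw [LieSubmodule.coe_bracket] at h
    rw [LieHom.lie_apply, hp w, h, sub_self]
  let D : LieDerivation K L N :=
    { toFun := fun x => ⟨⁅x, p⁆, hmem x⟩
      map_add' := fun x y => by
        ext1
        simp
      map_smul' := fun r x => by
        ext1
        simp
      leibniz' := fun a b => by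
        ext1
        simp only [LinearMap.coe_mk, AddHom.coe_mk, LieSubmodule.coe_sub,
          LieSubmodule.coe_bracket, lie_lie] }
  obtain ⟨⟨q, hqN⟩, hq⟩ := D.exists_eq_lie
  have hcomm : ∀ (x : L) (m : M), (p - q) ⁅x, m⁆ = ⁅x, (p - q) m⁆ := by
    intro x m
    have h1 : ⁅x, p⁆ = ⁅x, q⁆ := congrArg Subtype.val (hq x)
    have h2 : ⁅x, p - q⁆ = 0 := by rw [lie_sub, h1, sub_self]
    have h3 := LinearMap.congr_fun h2 m
    rw [LieHom.lie_apply, LinearMap.zero_apply, sub_eq_zero] at h3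
    exact h3.symm
  have hid : ∀ w : W, (p - q) w = w := fun w => by
    rw [LinearMap.sub_apply, hp, hqN w, sub_zero]
  let e : M →ₗ⁅K, L⁆ W := { (p - q) with map_lie' := fun {x m} => hcomm x m }
  refine ⟨e.ker, ?_⟩
  exact (LinearMap.isCompl_of_proj (f := p - q) hid).symm

end Whitehead

/-! ### The weight derivation and its outerness -/

section TwoStepNilpotentRadical

variable {K L : Type*} [Field K] [LieRing L] [LieAlgebra K L]

/-- The centre of an ideal, as a module over the action of a subalgebra on the ideal. -/
def LieIdeal.centerLieSubmodule (I : LieIdeal K L) (S : LieSubalgebra K L) :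
    LieSubmodule K S I :=
  { (LieAlgebra.center K I).toSubmodule with
    lie_mem := by
      intro x z hz
      replace hz : z ∈ LieAlgebra.center K I := hz
      change ⁅x, z⁆ ∈ LieAlgebra.center K I
      rw [LieModule.mem_maxTrivSubmodule] at hz ⊢
      have hz' : ∀ a : I, ⁅(a : L), (z : L)⁆ = 0 := fun a => congrArg Subtype.val (hz a)
      intro a
      ext
      change ⁅(a : L), ⁅(x : L), (z : L)⁆⁆ = 0
      have h := hz' ⁅(x : L), a⁆
      rw [LieSubmodule.coe_bracket, lie_lie, hz' a, lie_zero, zero_sub, neg_eq_zero] at h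
      exact h }

/-- Given a subalgebra `S` complementary to an ideal `I` with `[I, I] ⊆ Z(I)`, and an `S`-stable
complement `V` of `Z(I)` in `I`, there is a derivation acting as `0` on `S`, `1` on `Z(I)`
and `1/2` on `V`. -/
theorem LieDerivation.exists_of_isCompl_center [NeZero (2 : K)] {S : LieSubalgebra K L}
    {I : LieIdeal K L} (hSI : IsCompl S.toSubmodule I.toSubmodule)
    (hcomm : ⁅(⊤ : LieIdeal K I), (⊤ : LieIdeal K I)⁆ ≤ LieAlgebra.center K I)
    {V : LieSubmodule K S I} (hV : IsCompl V.toSubmodule (LieAlgebra.center K I).toSubmodule) :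
    ∃ D : LieDerivation K L L, (∀ x ∈ S, D x = 0) ∧
      (∀ z ∈ LieAlgebra.center K I, D (z : L) = (z : L)) ∧
      (∀ v ∈ V, D (v : L) = (1 / 2 : K) • (v : L)) := by
  let Z := LieAlgebra.center K I
  let π : L →ₗ[K] I := Submodule.projectionOnto _ _ hSI.symm
  let E : I →ₗ[K] I := LinearMap.id - (1 / 2 : K) • Submodule.projection _ _ hV
  have hπS : ∀ x ∈ S, π x = 0 := fun x hx =>
    (Submodule.projectionOnto_apply_eq_zero_iff hSI.symm).mpr hx
  have hπI : ∀ x : I, π x = x := fun x => Submodule.projectionOnto_apply_left hSI.symm x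
  have hEZ : ∀ z ∈ Z, E z = z := fun z hz => by
    have : Submodule.projection _ _ hV z = 0 :=
      (Submodule.projection_apply_eq_zero_iff hV).mpr hz
    simp [E, this]
  have hEV : ∀ v ∈ V, E v = (1 / 2 : K) • v := fun v hv => by
    have h : Submodule.projection _ _ hV v = v :=
      Submodule.projection_apply_left hV ⟨v, hv⟩
    have h2 : (2 : K) ≠ 0 := NeZero.ne 2
    have h3 : (1 : K) - 1 / 2 = 1 / 2 := by field_simp; norm_num
    calc E v = (1 : K) • v - (1 / 2 : K) • v := by simp [E, h]
      _ = _ := by rw [← sub_smul, h3]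
  have hdec : ∀ a : I, ∃ v ∈ V, ∃ z ∈ Z, v + z = a := fun a =>
    Submodule.mem_sup.mp (hV.sup_eq_top ▸ Submodule.mem_top : a ∈ V.toSubmodule ⊔ Z.toSubmodule)
  have hZr : ∀ (a : I), ∀ z ∈ Z, ⁅a, z⁆ = 0 := fun a z hz =>
    (LieModule.mem_maxTrivSubmodule K I I z).mp hz a
  have hZl : ∀ (a : I), ∀ z ∈ Z, ⁅z, a⁆ = 0 := fun a z hz => by
    rw [← lie_skew, hZr a z hz, neg_zero]
  have hIZ : ∀ a b : I, ⁅a, b⁆ ∈ Z := fun a b =>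
    hcomm (LieSubmodule.lie_mem_lie (LieSubmodule.mem_top a) (LieSubmodule.mem_top b))
  have hES : ∀ (s : S) (a : I), E ⁅s, a⁆ = ⁅s, E a⁆ := by
    intro s a
    obtain ⟨v, hv, z, hz, rfl⟩ := hdec a
    have hz' : ⁅s, z⁆ ∈ Z := (I.centerLieSubmodule S).lie_mem (x := s) hz
    rw [lie_add, map_add, map_add, hEV v hv, hEZ z hz, hEV _ (V.lie_mem hv), hEZ _ hz', lie_add,
      lie_smul]
  -- Only the `V`-components contribute to the bracket, and 1/2 + 1/2 = 1 is the weight of `Z`.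
  have hEI : ∀ a b : I, ⁅a, b⁆ = ⁅a, E b⁆ - ⁅b, E a⁆ := by
    intro a b
    obtain ⟨v, hv, z, hz, rfl⟩ := hdec a
    obtain ⟨w, hw, y, hy, rfl⟩ := hdec b
    have h2 : (2 : K) ≠ 0 := NeZero.ne 2
    simp only [map_add, hEV v hv, hEV w hw, hEZ z hz, hEZ y hy, lie_add, add_lie, lie_smul,
      hZl _ z hz, hZl _ y hy, hZr _ z hz, hZr _ y hy, add_zero]
    rw [← lie_skew w v, smul_neg, sub_neg_eq_add, ← add_smul, add_halves, one_smul]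
  have hEI' : ∀ a b : I, E ⁅a, b⁆ = ⁅a, E b⁆ - ⁅b, E a⁆ := fun a b => by
    rw [hEZ _ (hIZ a b), ← hEI]
  let T : L →ₗ[K] L := I.toSubmodule.subtype ∘ₗ E ∘ₗ π
  have hTS : ∀ x ∈ S, T x = 0 := fun x hx => by simp [T, hπS x hx]
  have hTI : ∀ a : I, T a = E a := fun a => by simp [T, hπI a]
  have hTSI : ∀ (s : S) (a : I), T ⁅(s : L), (a : L)⁆ = ⁅(s : L), (E a : L)⁆ := fun s a =>
    (hTI ⁅s, a⁆).trans (congrArg Subtype.val (hES s a))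
  have hTII : ∀ a b : I, T ⁅(a : L), (b : L)⁆ = ⁅(a : L), (E b : L)⁆ - ⁅(b : L), (E a : L)⁆ :=
    fun a b => (hTI ⁅a, b⁆).trans (congrArg Subtype.val (hEI' a b))
  have hdecL : ∀ x : L, ∃ s : S, ∃ a : I, (s : L) + a = x := fun x => by
    obtain ⟨s, hs, a, ha, h⟩ := Submodule.mem_sup.mp
      (hSI.sup_eq_top ▸ Submodule.mem_top : x ∈ S.toSubmodule ⊔ I.toSubmodule)
    exact ⟨⟨s, hs⟩, ⟨a, ha⟩, h⟩
  refine ⟨⟨T, fun x y => ?_⟩, hTS, fun z hz => ?_, fun v hv => ?_⟩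
  · obtain ⟨s, a, rfl⟩ := hdecL x
    obtain ⟨t, b, rfl⟩ := hdecL y
    have hat : T ⁅(a : L), (t : L)⁆ = - ⁅(t : L), (E a : L)⁆ := by
      rw [← lie_skew, map_neg, hTSI]
    simp only [map_add, add_lie, lie_add, hTS _ s.2, hTS _ t.2, hTI, hTSI, hTII, hat, zero_add,
      hTS _ (S.lie_mem s.2 t.2)]
    abel
  · exact (hTI z).trans (congrArg Subtype.val (hEZ z hz))
  · exact (hTI v).trans (congrArg Subtype.val (hEV v hv))

/-- A derivation that vanishes on a centreless complement of a nonzero ideal `I` with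
`[I, I] ⊆ Z(I)` and is the identity on `Z(I)` is not inner. -/
theorem not_lieDerivationIsInner_of_isCompl {S : LieSubalgebra K L}
    {I : LieIdeal K L} (hSI : IsCompl S.toSubmodule I.toSubmodule)
    (hS : LieAlgebra.center K S = ⊥) (hI : I ≠ ⊥)
    (hcomm : ⁅(⊤ : LieIdeal K I), (⊤ : LieIdeal K I)⁆ ≤ LieAlgebra.center K I)
    {D : LieDerivation K L L} (hDS : ∀ x ∈ S, D x = 0)
    (hDZ : ∀ z ∈ LieAlgebra.center K I, D (z : L) = (z : L)) : ¬ LieDerivationIsInner D := by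
  rintro ⟨x, hx⟩
  have hD : ∀ y, D y = ⁅x, y⁆ := fun y => by
    rw [← hx]
    exact LinearMap.congr_fun (LieDerivation.coe_ad_apply_eq_ad_apply (R := K) x) y
  obtain ⟨s, hs, a, ha, rfl⟩ := Submodule.mem_sup.mp
      (hSI.sup_eq_top ▸ Submodule.mem_top : x ∈ S.toSubmodule ⊔ I.toSubmodule)
  have hs0 : (⟨s, hs⟩ : S) ∈ LieAlgebra.center K S := by
    rw [LieModule.mem_maxTrivSubmodule]
    intro y
    ext
    change ⁅(y : L), s⁆ = 0
    have h := hDS y y.2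
    rw [hD, add_lie] at h
    -- `⁅s, y⁆ = -⁅a, y⁆` lies in both `S` and `I`, hence is zero.
    have h1 : ⁅s, (y : L)⁆ ∈ I.toSubmodule := by
      rw [eq_neg_of_add_eq_zero_left h]
      exact I.toSubmodule.neg_mem (lie_mem_left K L I a y ha)
    have h2 := Submodule.disjoint_def.mp hSI.disjoint _ (S.lie_mem hs y.2) h1
    rw [← lie_skew, h2, neg_zero]
  rw [hS, LieSubmodule.mem_bot] at hs0
  obtain rfl : s = 0 := congrArg Subtype.val hs0
  have hZ : ∀ z ∈ LieAlgebra.center K I, z = 0 := by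
    intro z hz
    have h := hDZ z hz
    have h' : ⁅(⟨a, ha⟩ : I), z⁆ = 0 := (LieModule.mem_maxTrivSubmodule K I I z).mp hz _
    rw [hD, zero_add] at h
    ext
    exact h.symm.trans (congrArg Subtype.val h')
  -- With `Z(I) = 0`, the inclusion `[I, I] ⊆ Z(I)` makes `I` abelian, so `I` equals its own zero
  -- centre.
  refine hI ((LieSubmodule.eq_bot_iff I).mpr fun b hb => ?_)
  refine congrArg Subtype.val (hZ ⟨b, hb⟩ ((LieModule.mem_maxTrivSubmodule K I I _).mpr fun c => ?_))
  exact hZ _ (hcomm (LieSubmodule.lie_mem_lie (LieSubmodule.mem_top _) (LieSubmodule.mem_top _)))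

end TwoStepNilpotentRadical

theorem mainTheorem6 {𝔤 : Type*} [LieRing 𝔤] [LieAlgebra ℂ 𝔤] [FiniteDimensional ℂ 𝔤]
    (𝔤L : LieSubalgebra ℂ 𝔤) (hLevi : IsLeviSubalgebra 𝔤L) (hsimple : LieAlgebra.IsSimple ℂ 𝔤L)
    (hperfect : LieIsPerfect ℂ 𝔤)
    (hrad : LieAlgebra.radical ℂ 𝔤 ≠ ⊥)
    (hcomm : ⁅(⊤ : LieIdeal ℂ (LieAlgebra.radical ℂ 𝔤)),
        (⊤ : LieIdeal ℂ (LieAlgebra.radical ℂ 𝔤))⁆ ≤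
      LieAlgebra.center ℂ (LieAlgebra.radical ℂ 𝔤)) :
    ¬ LieIsSympathetic ℂ 𝔤 ∧
    -- there is a `𝔤L`-submodule of the radical complementary to its centre
    (∃ V : LieSubmodule ℂ 𝔤L (LieAlgebra.radical ℂ 𝔤),
      IsCompl V.toSubmodule (LieAlgebra.center ℂ (LieAlgebra.radical ℂ 𝔤)).toSubmodule) ∧
    -- and for every such submodule the map described is well defined and is an outer derivation
    (∀ V : LieSubmodule ℂ 𝔤L (LieAlgebra.radical ℂ 𝔤),
      IsCompl V.toSubmodule (LieAlgebra.center ℂ (LieAlgebra.radical ℂ 𝔤)).toSubmodule →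
      ∃ D : LieDerivation ℂ 𝔤 𝔤,
        (∀ x ∈ 𝔤L, D x = 0) ∧
        (∀ z ∈ LieAlgebra.center ℂ (LieAlgebra.radical ℂ 𝔤), D (z : 𝔤) = (z : 𝔤)) ∧
        (∀ v ∈ V, D (v : 𝔤) = (1 / 2 : ℂ) • (v : 𝔤)) ∧
        ¬ LieDerivationIsInner D) := by
  have hout : ∀ V : LieSubmodule ℂ 𝔤L (LieAlgebra.radical ℂ 𝔤),
      IsCompl V.toSubmodule (LieAlgebra.center ℂ (LieAlgebra.radical ℂ 𝔤)).toSubmodule →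
      ∃ D : LieDerivation ℂ 𝔤 𝔤,
        (∀ x ∈ 𝔤L, D x = 0) ∧
        (∀ z ∈ LieAlgebra.center ℂ (LieAlgebra.radical ℂ 𝔤), D (z : 𝔤) = (z : 𝔤)) ∧
        (∀ v ∈ V, D (v : 𝔤) = (1 / 2 : ℂ) • (v : 𝔤)) ∧
        ¬ LieDerivationIsInner D := by
    intro V hV
    obtain ⟨D, h0, h1, h2⟩ := LieDerivation.exists_of_isCompl_center hLevi.isCompl hcomm hV
    exact ⟨D, h0, h1, h2, not_lieDerivationIsInner_of_isCompl hLevi.isCompl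
      (LieAlgebra.center_eq_bot ℂ 𝔤L) hrad hcomm h0 h1⟩
  obtain ⟨V, hV⟩ := LieSubmodule.exists_isCompl_toSubmodule
    ((LieAlgebra.radical ℂ 𝔤).centerLieSubmodule 𝔤L)
  refine ⟨fun h => ?_, ⟨V, hV⟩, hout⟩
  obtain ⟨D, -, -, -, hD⟩ := hout V hV
  exact hD (h.inner D)
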